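/- **Setting.** A pointed $k$-chain on $\mathbb R^n$ is a finite formal sum $A=\sum_i(p_i;\alpha_i)$ with $p_i\in\mathbb R^n$ and $\alpha_i\in\Lambda^kT_{p_i}\mathbb R^n$, i.e. a finitely supported section of $\Lambda^kT\mathbb R^n$. For $u\in\mathbb R^n$ let $\Delta_u(p;\alpha)=(p+u;\alpha)-(p;\alpha)$, extended linearly, and for a finite list $U=(u_1,\dots,u_j)$ put $\Delta_U=\Delta_{u_1}\circ\dots\circ\Delta_{u_j}$ and $|\Delta_U(p;\alpha)|_j=\|u_1\|\cdots\|u_j\|\,\|\alpha\|$, where $\|\alpha\|$ is the mass of $\alpha$. For an integer $r\ge 0$ the $r$-norm of $A$ is $$\|A\|_{B^r}=\inf\Big\{\sum_i|\Delta_{U_i}(p_i;\alpha_i)|_{j_i}\;:\;A=\sum_i\Delta_{U_i}(p_i;\alpha_i),\ 0\le j_i\le r\Big\},$$ where $j_i$ is the length of $U_i$. The space $\hat{\mathcal B}^r_k(\mathbb R^n)$ of differential $k$-chains of order $r$ is the completion of the pointed $k$-chains in the $r$-norm. For $v\in\mathbb R^n$ and $r\ge 1$, the prederivative $P_v:\hat{\mathcal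 B}^r_k\to\hat{\mathcal B}^{r+1}_k$ is the continuous extension of $P_vA=\lim_{t\to0}t^{-1}\Delta_{tv}A$, and the retraction $E_v^\dagger:\hat{\mathcal B}_1^r\to\hat{\mathcal B}_0^r$ is the continuous extension of $(p;\alpha)\mapsto(p;\langle v,\alpha\rangle)$. The boundary of a $1$-chain is $\partial=\sum_iP_{v_i}\circ E_{v_i}^\dagger:\hat{\mathcal B}_1^r\to\hat{\mathcal B}_0^{r+1}$ for an orthonormal basis $(v_i)$; $J$ is closed if $\partial J=0$. A closed set $X$ supports $J\in\hat{\mathcal B}^r_k(\mathbb R^n)$ if for every non-empty open $W\supseteq X$ there are pointed chains $A_i$ supported in $W$ with $A_i\to J$ in $\hat{\mathcal B}^r_k(\mathbb R^n)$; $\operatorname{supp}(J)$ is the intersection of all closed sets that support $J$, and $J$ is compactly supported if $\operatorname{supp}(J)$ is compact. Identify $\mathbb R^2$ with $\mathbb C$. For $J\in\hat{\mathcal B}_1^r(\mathbb R^2)$ and $z\notin\operatorname{supp}(J)$ the generalized winding number is $$\operatorname{Ind}_J(z)=\frac1{2\pi i}\int_J\frac{dw}{w-z},$$ where the integral is the limit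 of $\sum_i\alpha_i/(p_i-z)$ as the pointed chains $A=\sum_i(p_i;\alpha_i)$ converge to $J$ in the $r$-norm with $A$ eventually supported in each neighbourhood of $\operatorname{supp}(J)$. **Theorem.** Let $r\ge1$ and let $J\in\hat{\mathcal B}_1^r(\mathbb R^2)$ be closed and compactly supported. Then for every $z\in\operatorname{supp}(J)^c$ the integral defining $\operatorname{Ind}_J(z)$ is well defined (such approximating pointed chains exist, and the limit exists), and the function $\operatorname{Ind}_J$ is constant on each connected component of $\operatorname{supp}(J)^c$. -/

import Mathlib

open Filter Topology UniformSpace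

set_option linter.unusedSectionVars false

noncomputable section

namespace HarrisonChain

/-! ### Pointed chains and difference chains

`E` is the ambient Euclidean space. A finitely supported section of `Λ^k T E` is a finitely
supported function `E →₀ V` with `V = Λ^k E`. Only `k = 0` and `k = 1` occur below, where
`Λ^0 E = ℝ` and `Λ^1 E = E`; in both cases the mass of a `k`-vector is its norm. -/

section Pointed

variable {E V : Type*} [NormedAddCommGroup E] [NormedAddCommGroup V] [NormedSpace ℝ V]

/-- The translation operator `T_u (p; α) = (p + u; α)`. -/
def translate (u : E) : (E →₀ V) →ₗ[ℝ] (E →₀ V) :=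
  Finsupp.lmapDomain V ℝ (fun p => p + u)

/-- The difference operator `Δ_u = T_u - Id`. -/
def diff (u : E) : (E →₀ V) →ₗ[ℝ] (E →₀ V) :=
  translate u - LinearMap.id

/-- The iterated difference operator `Δ_{u₁} ∘ ⋯ ∘ Δ_{u_j}`. -/
def iterDiff (U : List E) : Module.End ℝ (E →₀ V) :=
  (U.map diff).prod

/-- The data `(U, p, α)` of a difference chain, read as the chain `Δ_U (p; α)`. -/
def elemChain (t : List E × E × V) : E →₀ V :=
  iterDiff t.1 (Finsupp.single t.2.1 t.2.2)

/-- The quantity `|Δ_U (p; α)|_j = ‖u₁‖ ⋯ ‖u_j‖ ‖α‖`. -/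
def elemMass (t : List E × E × V) : ℝ :=
  (t.1.map norm).prod * ‖t.2.2‖

/-- All values `∑ |Δ_{U_i} (p_i; α_i)|` over the ways of writing `A = ∑ Δ_{U_i} (p_i; α_i)` with
every `U_i` of length at most `r`. -/
def massSet (r : ℕ) (A : E →₀ V) : Set ℝ :=
  {x | ∃ L : List (List E × E × V), (∀ t ∈ L, t.1.length ≤ r) ∧
    (L.map elemChain).sum = A ∧ (L.map elemMass).sum = x}

/-- The `r`-norm of a pointed chain. -/
def rNorm (r : ℕ) (A : E →₀ V) : ℝ := sInf (massSet r A)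

theorem elemMass_nonneg (t : List E × E × V) : 0 ≤ elemMass t := by
  refine mul_nonneg (List.prod_nonneg ?_) (norm_nonneg _)
  simp only [List.mem_map, forall_exists_index, and_imp]
  rintro _ u _ rfl
  exact norm_nonneg u

theorem massSet_nonneg {r : ℕ} {A : E →₀ V} {x : ℝ} (hx : x ∈ massSet r A) : 0 ≤ x := by
  obtain ⟨L, -, -, rfl⟩ := hx
  refine List.sum_nonneg ?_
  simp only [List.mem_map, forall_exists_index, and_imp]
  rintro _ t _ rfl
  exact elemMass_nonneg t

theorem massSet_bddBelow (r : ℕ) (A : E →₀ V) : BddBelow (massSet r A) :=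
  ⟨0, fun _ hx => massSet_nonneg hx⟩

theorem rNorm_nonneg (r : ℕ) (A : E →₀ V) : 0 ≤ rNorm r A :=
  Real.sInf_nonneg fun _ hx => massSet_nonneg hx

theorem massSet_add {r : ℕ} {A B : E →₀ V} {x y : ℝ} (hx : x ∈ massSet r A)
    (hy : y ∈ massSet r B) : x + y ∈ massSet r (A + B) := by
  obtain ⟨L, hL, rfl, rfl⟩ := hx
  obtain ⟨M, hM, rfl, rfl⟩ := hy
  refine ⟨L ++ M, ?_, by simp, by simp⟩
  intro t ht
  rcases List.mem_append.1 ht with h | h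
  · exact hL t h
  · exact hM t h

theorem massSet_elem {r : ℕ} (t : List E × E × V) (ht : t.1.length ≤ r) :
    elemMass t ∈ massSet r (elemChain t) :=
  ⟨[t], by simpa using ht, by simp, by simp⟩

theorem massSet_nonempty (r : ℕ) (A : E →₀ V) : (massSet r A).Nonempty := by
  induction A using Finsupp.induction_linear with
  | zero => exact ⟨0, [], by simp, by simp, by simp⟩
  | add A B hA hB =>
    obtain ⟨x, hx⟩ := hA
    obtain ⟨y, hy⟩ := hB
    exact ⟨x + y, massSet_add hx hy⟩
  | single p α =>
    have h := massSet_elem (r := r) (([] : List E), p, α) (by simp)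
    have e : elemChain (([] : List E), p, α) = Finsupp.single p α := by
      simp [elemChain, iterDiff]
    rw [e] at h
    exact ⟨_, h⟩

theorem rNorm_elem_le {r : ℕ} (t : List E × E × V) (ht : t.1.length ≤ r) :
    rNorm r (elemChain t) ≤ elemMass t :=
  csInf_le (massSet_bddBelow _ _) (massSet_elem t ht)

/-- A seminorm on pointed chains that is bounded on difference chains is bounded by the
`r`-norm. -/
theorem le_rNorm_of_elem {r : ℕ} (q : Seminorm ℝ (E →₀ V)) {C : ℝ} (hC : 0 ≤ C)
    (h : ∀ t : List E × E × V, t.1.length ≤ r → q (elemChain t) ≤ C * elemMass t)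
    (A : E →₀ V) : q A ≤ C * rNorm r A := by
  have key : ∀ x ∈ massSet r A, q A ≤ C * x := by
    rintro x ⟨L, hL, rfl, rfl⟩
    induction L with
    | nil => simp
    | cons t L ih =>
      simp only [List.map_cons, List.sum_cons]
      calc q (elemChain t + (L.map elemChain).sum)
          ≤ q (elemChain t) + q (L.map elemChain).sum := map_add_le_add _ _ _
        _ ≤ C * elemMass t + C * (L.map elemMass).sum :=
            add_le_add (h t (hL t (by simp))) (ih fun s hs => hL s (by simp [hs]))
        _ = C * (elemMass t + (L.map elemMass).sum) := by ring
  rcases hC.eq_or_lt with rfl | hC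
  · obtain ⟨x, hx⟩ := massSet_nonempty r A
    simpa using key x hx
  · rw [← div_le_iff₀' hC]
    exact le_csInf (massSet_nonempty r A) fun x hx => (div_le_iff₀' hC).2 (key x hx)

theorem elemChain_smul (c : ℝ) (t : List E × E × V) :
    elemChain (t.1, t.2.1, c • t.2.2) = c • elemChain t := by
  simp only [elemChain]
  rw [← Finsupp.smul_single, map_smul]

theorem elemMass_smul (c : ℝ) (t : List E × E × V) :
    elemMass (t.1, t.2.1, c • t.2.2) = |c| * elemMass t := by
  simp only [elemMass, norm_smul, Real.norm_eq_abs]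
  ring

/-- The `r`-norm, bundled as a seminorm. -/
def rSeminorm (E V : Type*) [NormedAddCommGroup E] [NormedAddCommGroup V] [NormedSpace ℝ V]
    (r : ℕ) : Seminorm ℝ (E →₀ V) :=
  Seminorm.ofSMulLE (rNorm r)
    (le_antisymm (csInf_le (massSet_bddBelow _ _) ⟨[], by simp, by simp, by simp⟩)
      (rNorm_nonneg _ _))
    (by
      intro A B
      have h : ∀ x ∈ massSet r A, ∀ y ∈ massSet r B, rNorm r (A + B) ≤ x + y :=
        fun x hx y hy => csInf_le (massSet_bddBelow _ _) (massSet_add hx hy)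
      have h2 : ∀ x ∈ massSet r A, rNorm r (A + B) - x ≤ rNorm r B := fun x hx =>
        le_csInf (massSet_nonempty r B) fun y hy => by linarith [h x hx y hy]
      have h3 : rNorm r (A + B) - rNorm r B ≤ rNorm r A :=
        le_csInf (massSet_nonempty r A) fun x hx => by linarith [h2 x hx]
      linarith)
    (by
      intro c A
      rw [Real.norm_eq_abs]
      have key : ∀ x ∈ massSet r A, rNorm r (c • A) ≤ |c| * x := by
        rintro x ⟨L, hL, rfl, rfl⟩
        refine csInf_le (massSet_bddBelow _ _)
          ⟨L.map fun t => (t.1, t.2.1, c • t.2.2), ?_, ?_, ?_⟩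
        · simp only [List.mem_map, forall_exists_index, and_imp]
          rintro _ t ht rfl
          exact hL t ht
        · rw [List.map_map, List.smul_sum, List.map_map]
          congr 1
          exact List.map_congr_left fun t _ => elemChain_smul c t
        · rw [List.map_map, ← List.sum_map_mul_left]
          congr 1
          exact List.map_congr_left fun t _ => elemMass_smul c t
      rcases (abs_nonneg c).eq_or_lt with h0 | h0
      · obtain ⟨x, hx⟩ := massSet_nonempty r A
        simpa [← h0] using key x hx
      · rw [← div_le_iff₀' h0]
        exact le_csInf (massSet_nonempty r A) fun x hx => (div_le_iff₀' h0).2 (key x hx))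

end Pointed

/-! ### Differential chains of order `r` -/

/-- The space of pointed chains on `E` with coefficients in `V`, carrying the `r`-norm. -/
def Pointed (E V : Type*) [NormedAddCommGroup E] [NormedAddCommGroup V] [NormedSpace ℝ V]
    (_r : ℕ) : Type _ := E →₀ V

section Chains

variable {E V : Type*} [NormedAddCommGroup E] [NormedAddCommGroup V] [NormedSpace ℝ V] {r : ℕ}

instance : AddCommGroup (Pointed E V r) := inferInstanceAs (AddCommGroup (E →₀ V))

instance : Module ℝ (Pointed E V r) := inferInstanceAs (Module ℝ (E →₀ V))

instance : SeminormedAddCommGroup (Pointed E V r) :=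
  AddGroupSeminorm.toSeminormedAddCommGroup (E := Pointed E V r)
    (rSeminorm E V r).toAddGroupSeminorm

instance : NormedSpace ℝ (Pointed E V r) where
  norm_smul_le c A := (map_smul_eq_mul (rSeminorm E V r) c A).le

/-- The pointed chain `A`, regarded as an element of the space with the `r`-norm. -/
def toPointed (r : ℕ) : (E →₀ V) ≃ₗ[ℝ] Pointed E V r := LinearEquiv.refl ℝ (E →₀ V)

theorem norm_toPointed (A : E →₀ V) : ‖toPointed r A‖ = rNorm r A := rfl

variable (E V) in
/-- The Banach space of differential chains of order `r`: the completion of the pointed chains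
in the `r`-norm. -/
abbrev DiffChain (r : ℕ) : Type _ := Completion (Pointed E V r)

/-- A pointed chain as a differential chain of order `r`. -/
def ofPointed (r : ℕ) : (E →₀ V) →ₗ[ℝ] DiffChain E V r :=
  (Completion.toComplL (𝕜 := ℝ) (E := Pointed E V r)).toLinearMap ∘ₗ (toPointed r).toLinearMap

theorem norm_ofPointed (A : E →₀ V) : ‖ofPointed r A‖ = rNorm r A :=
  Completion.norm_coe (toPointed r A)

theorem denseRange_ofPointed : DenseRange (ofPointed r : (E →₀ V) → DiffChain E V r) :=
  Completion.denseRange_coe (α := Pointed E V r)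

/-- A linear map that is bounded in the `r`-norm, extended by continuity from pointed chains to
differential chains of order `r`. -/
def extendBounded {W : Type*} [NormedAddCommGroup W] [NormedSpace ℝ W] [CompleteSpace W]
    (T : (E →₀ V) →ₗ[ℝ] W) (C : ℝ) (hT : ∀ A, ‖T A‖ ≤ C * rNorm r A) :
    DiffChain E V r →L[ℝ] W :=
  ((T ∘ₗ (toPointed r).symm.toLinearMap).mkContinuous C hT).extend Completion.toComplL

theorem extendBounded_ofPointed {W : Type*} [NormedAddCommGroup W] [NormedSpace ℝ W]
    [CompleteSpace W] (T : (E →₀ V) →ₗ[ℝ] W) (C : ℝ) (hT : ∀ A, ‖T A‖ ≤ C * rNorm r A)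
    (A : E →₀ V) : extendBounded T C hT (ofPointed r A) = T A :=
  ContinuousLinearMap.extend_eq
    (e := (Completion.toComplL : Pointed E V r →L[ℝ] DiffChain E V r))
    ((T ∘ₗ (toPointed r).symm.toLinearMap).mkContinuous C hT) Completion.denseRange_coe
    (Completion.isUniformInducing_coe (Pointed E V r)) (toPointed r A)

/-- A linear map that is bounded on difference chains is bounded in the `r`-norm. -/
theorem bound_of_elem {W : Type*} [SeminormedAddCommGroup W] [NormedSpace ℝ W]
    (T : (E →₀ V) →ₗ[ℝ] W) {C : ℝ} (hC : 0 ≤ C)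
    (h : ∀ t : List E × E × V, t.1.length ≤ r → ‖T (elemChain t)‖ ≤ C * elemMass t)
    (A : E →₀ V) : ‖T A‖ ≤ C * rNorm r A :=
  le_rNorm_of_elem ((normSeminorm ℝ W).comp T) hC h A

/-! ### Support -/

/-- The closed set `X` supports `J`: for every non-empty open `W ⊇ X`, the chain `J` is a limit
of pointed chains supported in `W`. -/
def Supports (X : Set E) (J : DiffChain E V r) : Prop :=
  ∀ W : Set E, W.Nonempty → IsOpen W → X ⊆ W →
    ∃ A : ℕ → (E →₀ V), (∀ i, ((A i).support : Set E) ⊆ W) ∧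
      Tendsto (fun i => ofPointed r (A i)) atTop (𝓝 J)

/-- The support of `J`: the intersection of all closed sets supporting `J`. -/
def supp (J : DiffChain E V r) : Set E :=
  ⋂₀ {X | IsClosed X ∧ Supports X J}

/-! ### Prederivative -/

theorem elemChain_cons (u : E) (t : List E × E × V) :
    elemChain (u :: t.1, t.2) = diff u (elemChain t) := by
  simp [elemChain, iterDiff]

theorem elemMass_cons (u : E) (t : List E × E × V) :
    elemMass (u :: t.1, t.2) = ‖u‖ * elemMass t := by
  simp [elemMass, mul_assoc]

theorem rNorm_smul (c : ℝ) (A : E →₀ V) : rNorm r (c • A) = |c| * rNorm r A :=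
  map_smul_eq_mul (rSeminorm E V r) c A

theorem rNorm_diff_le (u : E) (A : E →₀ V) :
    rNorm (r + 1) (diff u A) ≤ ‖u‖ * rNorm r A := by
  refine le_rNorm_of_elem ((rSeminorm E V (r + 1)).comp (diff u)) (norm_nonneg u) ?_ A
  intro t ht
  change rNorm (r + 1) (diff u (elemChain t)) ≤ _
  rw [← elemChain_cons, ← elemMass_cons]
  exact rNorm_elem_le _ (by simpa using ht)

theorem translate_translate (u v : E) (A : E →₀ V) :
    translate u (translate v A) = translate (u + v) A := by
  simp only [translate, Finsupp.lmapDomain_apply, ← Finsupp.mapDomain_comp]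
  congr 1
  funext p
  simp only [Function.comp]
  abel

theorem diff_add_sub (u v : E) (A : E →₀ V) :
    diff (u + v) A - diff u A - diff v A = diff u (diff v A) := by
  simp only [diff, LinearMap.sub_apply, LinearMap.id_apply, map_sub, translate_translate]
  abel

theorem rNorm_mono {r s : ℕ} (h : r ≤ s) (A : E →₀ V) : rNorm s A ≤ rNorm r A :=
  csInf_le_csInf (massSet_bddBelow _ _) (massSet_nonempty _ _)
    fun _ ⟨L, hL, hA, hx⟩ => ⟨L, fun t ht => (hL t ht).trans h, hA, hx⟩

/-- A nearly additive Lipschitz curve has a derivative at `0`. -/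
theorem exists_tendsto_inv_smul {X : Type*} [NormedAddCommGroup X] [NormedSpace ℝ X]
    [CompleteSpace X] (f : ℝ → X) (K C : ℝ) (hK : ∀ s t, ‖f (s + t) - f s - f t‖ ≤ K * (|s| * |t|))
    (hC : ∀ t, ‖f t‖ ≤ C * |t|) :
    ∃ L, Tendsto (fun t : ℝ => t⁻¹ • f t) (𝓝[≠] 0) (𝓝 L) := by
  have hd : ∀ (t : ℝ) (n : ℕ), dist ((2 : ℝ) ^ n • f (t / 2 ^ n))
      ((2 : ℝ) ^ (n + 1) • f (t / 2 ^ (n + 1))) ≤ K * t ^ 2 / 2 / 2 / 2 ^ n := by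
    intro t n
    have h1 := hK (t / 2 ^ (n + 1)) (t / 2 ^ (n + 1))
    have e : t / 2 ^ (n + 1) + t / 2 ^ (n + 1) = t / 2 ^ n := by
      rw [pow_succ]; field_simp; norm_num
    rw [e] at h1
    have e2 : (2 : ℝ) ^ n • f (t / 2 ^ n) - (2 : ℝ) ^ (n + 1) • f (t / 2 ^ (n + 1))
        = (2 : ℝ) ^ n • (f (t / 2 ^ n) - f (t / 2 ^ (n + 1)) - f (t / 2 ^ (n + 1))) := by
      rw [pow_succ, mul_smul, two_smul, smul_sub, smul_sub, smul_add]; abel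
    rw [dist_eq_norm, e2, norm_smul]
    have e3 : |t / 2 ^ (n + 1)| * |t / 2 ^ (n + 1)| = t ^ 2 / (2 ^ (n + 1)) ^ 2 := by
      rw [abs_mul_abs_self]; ring
    rw [e3] at h1
    calc ‖(2 : ℝ) ^ n‖ * _ ≤ 2 ^ n * (K * (t ^ 2 / (2 ^ (n + 1)) ^ 2)) := by
          rw [Real.norm_of_nonneg (by positivity)]
          exact mul_le_mul_of_nonneg_left h1 (by positivity)
      _ = K * t ^ 2 / 2 / 2 / 2 ^ n := by
          rw [pow_succ]; field_simp; ring
  have hlim : ∀ t : ℝ, ∃ F, Tendsto (fun n : ℕ => (2 : ℝ) ^ n • f (t / 2 ^ n)) atTop (𝓝 F) :=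
    fun t => cauchySeq_tendsto_of_complete (cauchySeq_of_le_geometric_two (hd t))
  choose F hF using hlim
  have hfF : ∀ t, ‖f t - F t‖ ≤ K * t ^ 2 / 2 := by
    intro t
    have := dist_le_of_le_geometric_two_of_tendsto₀ (hd t) (hF t)
    simpa [dist_eq_norm] using this
  have hFadd : ∀ s t, F (s + t) = F s + F t := by
    intro s t
    have h1 : Tendsto (fun n : ℕ => (2 : ℝ) ^ n • f ((s + t) / 2 ^ n) -
        (2 : ℝ) ^ n • f (s / 2 ^ n) - (2 : ℝ) ^ n • f (t / 2 ^ n)) atTop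
        (𝓝 (F (s + t) - F s - F t)) := ((hF _).sub (hF _)).sub (hF _)
    have h2 : Tendsto (fun n : ℕ => (2 : ℝ) ^ n • f ((s + t) / 2 ^ n) -
        (2 : ℝ) ^ n • f (s / 2 ^ n) - (2 : ℝ) ^ n • f (t / 2 ^ n)) atTop (𝓝 0) := by
      refine squeeze_zero_norm (a := fun n : ℕ => K * (|s| * |t|) * (1 / 2) ^ n) ?_ ?_
      · intro n
        rw [← smul_sub, ← smul_sub, norm_smul, Real.norm_of_nonneg (by positivity), add_div]
        calc (2 : ℝ) ^ n * _ ≤ 2 ^ n * (K * (|s / 2 ^ n| * |t / 2 ^ n|)) :=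
              mul_le_mul_of_nonneg_left (hK _ _) (by positivity)
          _ = K * (|s| * |t|) * (1 / 2) ^ n := by
              rw [abs_div, abs_div, abs_of_pos (show (0 : ℝ) < 2 ^ n by positivity),
                div_pow, one_pow]
              field_simp
      · have := tendsto_pow_atTop_nhds_zero_of_lt_one (r := (1 / 2 : ℝ)) (by norm_num)
          (by norm_num)
        simpa using this.const_mul (K * (|s| * |t|))
    have := tendsto_nhds_unique h1 h2
    rw [sub_sub, sub_eq_zero] at this
    exact this
  have hFb : ∀ t, ‖F t‖ ≤ C * |t| := by
    intro t
    refine le_of_tendsto (hF t).norm (Eventually.of_forall fun n => ?_)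
    rw [norm_smul, Real.norm_of_nonneg (by positivity)]
    calc (2 : ℝ) ^ n * _ ≤ 2 ^ n * (C * |t / 2 ^ n|) :=
          mul_le_mul_of_nonneg_left (hC _) (by positivity)
      _ = C * |t| := by
          rw [abs_div, abs_of_pos (show (0 : ℝ) < 2 ^ n by positivity)]
          field_simp
  let G : ℝ →+ X := AddMonoidHom.mk' F hFadd
  have hG : Continuous G := AddMonoidHomClass.continuous_of_bound G C fun t => hFb t
  have hlin : ∀ t : ℝ, F t = t • F 1 := by
    intro t
    have := map_real_smul G hG t 1
    rwa [smul_eq_mul, mul_one] at this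
  refine ⟨F 1, ?_⟩
  rw [tendsto_iff_norm_sub_tendsto_zero]
  refine squeeze_zero' (g := fun t : ℝ => K / 2 * |t|)
    (Eventually.of_forall fun _ => norm_nonneg _) ?_ ?_
  · filter_upwards [self_mem_nhdsWithin] with t ht
    have ht : t ≠ 0 := ht
    have e : t⁻¹ • f t - F 1 = t⁻¹ • (f t - F t) := by
      rw [smul_sub, hlin t, smul_smul, inv_mul_cancel₀ ht, one_smul]
    rw [e, norm_smul, norm_inv, Real.norm_eq_abs]
    have h0 : 0 < |t| := abs_pos.2 ht
    rw [inv_mul_le_iff₀ h0]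
    calc ‖f t - F t‖ ≤ K * t ^ 2 / 2 := hfF t
      _ = |t| * (K / 2 * |t|) := by rw [← sq_abs]; ring
  · have h : Tendsto (fun t : ℝ => K / 2 * |t|) (𝓝 0) (𝓝 (K / 2 * |0|)) :=
      (continuous_const.mul continuous_abs).tendsto 0
    simpa using h.mono_left nhdsWithin_le_nhds

section Prederivative

variable [NormedSpace ℝ E]

/-- The difference quotient `Δ_{tv} (A / t)`, as a differential chain of order `r`. -/
def diffQuot (r : ℕ) (v : E) (t : ℝ) : (E →₀ V) →ₗ[ℝ] DiffChain E V r :=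
  ofPointed r ∘ₗ (t⁻¹ • diff (t • v))

theorem exists_tendsto_diffQuot (hr : 1 ≤ r) (v : E) (A : E →₀ V) :
    ∃ L, Tendsto (fun t : ℝ => diffQuot (r + 1) v t A) (𝓝[≠] 0) (𝓝 L) := by
  have hb : ∀ (s : ℝ) (n : ℕ) (B : E →₀ V),
      rNorm (n + 1) (diff (s • v) B) ≤ |s| * (‖v‖ * rNorm n B) := by
    intro s n B
    have := rNorm_diff_le (r := n) (s • v) B
    rwa [norm_smul, Real.norm_eq_abs, mul_assoc] at this
  obtain ⟨n, rfl⟩ := Nat.exists_eq_add_of_le' hr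
  have h := exists_tendsto_inv_smul (fun t : ℝ => ofPointed (n + 1 + 1) (diff (t • v) A))
    (‖v‖ * (‖v‖ * rNorm n A)) (‖v‖ * rNorm (n + 1) A) ?_ ?_
  · simpa [diffQuot] using h
  · intro s t
    rw [← map_sub, ← map_sub, add_smul, diff_add_sub, norm_ofPointed]
    refine (hb s (n + 1) _).trans ?_
    calc |s| * (‖v‖ * rNorm (n + 1) (diff (t • v) A))
        ≤ |s| * (‖v‖ * (|t| * (‖v‖ * rNorm n A))) := by
          gcongr
          exact hb t n A
      _ = ‖v‖ * (‖v‖ * rNorm n A) * (|s| * |t|) := by ring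
  · intro t
    rw [norm_ofPointed, mul_comm]
    exact hb t (n + 1) A

theorem norm_diffQuot_le (v : E) {t : ℝ} (ht : t ≠ 0) (A : E →₀ V) :
    ‖diffQuot (r + 1) v t A‖ ≤ ‖v‖ * rNorm r A := by
  have h := rNorm_diff_le (r := r) (t • v) A
  rw [norm_smul, Real.norm_eq_abs, mul_assoc] at h
  change ‖ofPointed (r + 1) (t⁻¹ • diff (t • v) A)‖ ≤ _
  rw [norm_ofPointed, rNorm_smul, abs_inv, inv_mul_le_iff₀ (abs_pos.2 ht)]
  exact h

/-- The prederivative of a pointed chain, `P_v A = lim_{t → 0} Δ_{tv} (A / t)`, a differential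
chain of order `r + 1`. -/
def prederivPointed (hr : 1 ≤ r) (v : E) : (E →₀ V) →ₗ[ℝ] DiffChain E V (r + 1) where
  toFun A := limUnder (𝓝[≠] (0 : ℝ)) fun t => diffQuot (r + 1) v t A
  map_add' A B := by
    refine Tendsto.limUnder_eq ?_
    simp only [map_add]
    exact (tendsto_nhds_limUnder (exists_tendsto_diffQuot hr v A)).add
      (tendsto_nhds_limUnder (exists_tendsto_diffQuot hr v B))
  map_smul' c A := by
    refine Tendsto.limUnder_eq ?_
    simp only [map_smul, RingHom.id_apply]
    exact (tendsto_nhds_limUnder (exists_tendsto_diffQuot hr v A)).const_smul c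

theorem tendsto_prederivPointed (hr : 1 ≤ r) (v : E) (A : E →₀ V) :
    Tendsto (fun t : ℝ => diffQuot (r + 1) v t A) (𝓝[≠] 0) (𝓝 (prederivPointed hr v A)) :=
  tendsto_nhds_limUnder (exists_tendsto_diffQuot hr v A)

theorem norm_prederivPointed_le (hr : 1 ≤ r) (v : E) (A : E →₀ V) :
    ‖prederivPointed hr v A‖ ≤ ‖v‖ * rNorm r A :=
  le_of_tendsto (tendsto_prederivPointed hr v A).norm
    (by filter_upwards [self_mem_nhdsWithin] with t ht using norm_diffQuot_le v ht A)

/-- The prederivative `P_v`, from chains of order `r ≥ 1` to chains of order `r + 1`. -/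
def prederiv (hr : 1 ≤ r) (v : E) : DiffChain E V r →L[ℝ] DiffChain E V (r + 1) :=
  extendBounded (prederivPointed hr v) ‖v‖ (norm_prederivPointed_le hr v)

end Prederivative

/-! ### Retraction of `1`-chains and boundary -/

section Retraction

variable [InnerProductSpace ℝ E]

/-- Retraction of pointed `1`-chains: `E†_v (p; α) = (p; ⟪v, α⟫)`. -/
def retractPointed (v : E) : (E →₀ E) →ₗ[ℝ] (E →₀ ℝ) :=
  Finsupp.mapRange.linearMap (innerSL ℝ v).toLinearMap

theorem retract_translate (v u : E) (A : E →₀ E) :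
    retractPointed v (translate u A) = translate u (retractPointed v A) := by
  simp only [retractPointed, translate, Finsupp.lmapDomain_apply, Finsupp.mapRange.linearMap_apply]
  exact (Finsupp.mapDomain_mapRange _ A _ (inner_zero_right v)
    (fun x y => inner_add_right v x y)).symm

theorem retract_elemChain (v : E) (t : List E × E × E) :
    retractPointed v (elemChain t) = elemChain (t.1, t.2.1, inner ℝ v t.2.2) := by
  obtain ⟨U, p, α⟩ := t
  induction U with
  | nil => simp [elemChain, iterDiff, retractPointed]
  | cons u U ih =>
    have e1 := elemChain_cons u (U, p, α)
    have e2 := elemChain_cons u (U, p, (inner ℝ v α : ℝ))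
    simp only at e1 e2 ih ⊢
    rw [e1, e2, ← ih]
    simp only [diff, LinearMap.sub_apply, LinearMap.id_apply, map_sub, retract_translate]

theorem norm_retractPointed_le (v : E) (A : E →₀ E) :
    ‖(ofPointed r ∘ₗ retractPointed v) A‖ ≤ ‖v‖ * rNorm r A := by
  refine bound_of_elem _ (norm_nonneg v) (fun t ht => ?_) A
  rw [LinearMap.comp_apply, norm_ofPointed, retract_elemChain]
  refine (rNorm_elem_le (t.1, t.2.1, (inner ℝ v t.2.2 : ℝ)) ht).trans ?_
  have h0 : 0 ≤ (t.1.map norm).prod := by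
    refine List.prod_nonneg ?_
    simp only [List.mem_map, forall_exists_index, and_imp]
    rintro _ u _ rfl
    exact norm_nonneg u
  calc (t.1.map norm).prod * ‖(inner ℝ v t.2.2 : ℝ)‖
      ≤ (t.1.map norm).prod * (‖v‖ * ‖t.2.2‖) :=
        mul_le_mul_of_nonneg_left (norm_inner_le_norm _ _) h0
    _ = ‖v‖ * elemMass t := by simp only [elemMass]; ring

/-- The retraction `E†_v` from `1`-chains to `0`-chains of order `r`. -/
def retract (v : E) : DiffChain E E r →L[ℝ] DiffChain E ℝ r :=
  extendBounded (ofPointed r ∘ₗ retractPointed v) ‖v‖ (norm_retractPointed_le v)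

end Retraction

end Chains

/-! ### Chains in the plane -/

/-- Differential `1`-chains of order `r` in the plane `ℝ² ≃ ℂ`. -/
abbrev PlaneChain (r : ℕ) : Type := DiffChain ℂ ℂ r

/-- The boundary `∂ = ∑ P_{v_i} ∘ E†_{v_i}` of plane `1`-chains, for the orthonormal basis
`1, i`. -/
def boundary {r : ℕ} (hr : 1 ≤ r) : PlaneChain r →L[ℝ] DiffChain ℂ ℝ (r + 1) :=
  ∑ i, (prederiv hr (Complex.orthonormalBasisOneI i)).comp
    (retract (Complex.orthonormalBasisOneI i))

/-- The value `∑ ω_{p_i}(α_i)` of a complex-valued `1`-form on a pointed `1`-chain. -/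
def evalForm (ω : ℂ → (ℂ →ₗ[ℝ] ℂ)) (A : ℂ →₀ ℂ) : ℂ :=
  A.sum fun p α => ω p α

/-- The `1`-form `f(w) dw`. -/
def formDw (f : ℂ → ℂ) : ℂ → (ℂ →ₗ[ℝ] ℂ) :=
  fun w => LinearMap.mulLeft ℝ (f w)

/-- Approximation of `J` by pointed chains `A`: the filter expressing that `A → J` in the
`r`-norm while `A` is eventually supported in every neighbourhood of the support of `J`. -/
def approx {r : ℕ} (J : PlaneChain r) : Filter (ℂ →₀ ℂ) :=
  comap (ofPointed r) (𝓝 J) ⊓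
    comap (fun A : ℂ →₀ ℂ => (A.support : Set ℂ)) (𝓝ˢ (supp J)).smallSets

/-- The integral over `J` of the form `ω`, given near the support of `J`, exists and equals `c`:
there are pointed chains approximating `J`, and `ω(A) → c` as `A → J`. -/
def HasIntegral {r : ℕ} (J : PlaneChain r) (ω : ℂ → (ℂ →ₗ[ℝ] ℂ)) (c : ℂ) : Prop :=
  (approx J).NeBot ∧ Tendsto (evalForm ω) (approx J) (𝓝 c)

/-- The Harrison integral over `J` of a form `ω` given near the support of `J`: the extension by
continuity of the evaluation of `ω` on pointed chains. -/
def harrisonIntegral {r : ℕ} (J : PlaneChain r) (ω : ℂ → (ℂ →ₗ[ℝ] ℂ)) : ℂ :=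
  limUnder (approx J) (evalForm ω)

/-- The winding number `Ind_J(z) = (1 / 2πi) ∫_J dw / (w - z)`. -/
def windingNumber {r : ℕ} (J : PlaneChain r) (z : ℂ) : ℂ :=
  1 / (2 * Real.pi * Complex.I) * harrisonIntegral J (formDw fun w => 1 / (w - z))

end HarrisonChain

end

/-! Near `supp J` the forms `dw/(w - z)` and `dw/(w - z')` differ, for `z'` close to `z`, by an
exact form: off a closed disk around `z` that contains `z'` in its interior, `log (1 + (z - z')/(w -
z))` is a single-valued primitive. Stokes' theorem and `∂J = 0` make its integral vanish, so the
index is locally constant off the support, hence constant on components.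

Two facts give the integrals a meaning. By duality, a form whose iterated differences of order at
most `r` are bounded is continuous in the `r`-norm; a smooth compactly supported form qualifies, so
it pairs with every chain. A form smooth only near the support is first multiplied by a cutoff.

The harder fact is that a compactly supported chain can be approximated by pointed chains near `supp
J`, although `supp J` is only an intersection of supporting sets. Multiplication by a test function
is continuous on chains (`norm_mulPointed_le`). It kills `J` when the function's support misses one
supporting set, and by compactness also when it misses `supp J`
(`mulChain_eq_zero_of_disjoint_supp`). Hence a cutoff equal to `1` near `supp J` fixes `J`
(`mulChain_eq_self`), and multiplying approximations of `J` by it localizes them. -/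

noncomputable section

namespace HarrisonChain

open scoped ContDiff

/-! ### Iterated differences of functions -/

section FunDiff

variable {E F : Type*} [NormedAddCommGroup E] [NormedAddCommGroup F]

/-- The iterated difference of a function along a list of vectors, dual to `iterDiff`. -/
def funDiff : List E → (E → F) → E → F
  | [], f => f
  | u :: U, f => funDiff U (fun p => f (p + u) - f p)

theorem funDiff_cons (u : E) (U : List E) (f : E → F) :
    funDiff (u :: U) f = funDiff U (fun p => f (p + u) - f p) := rfl

theorem funDiff_comp_add (U : List E) (f : E → F) (u p : E) :
    funDiff U (fun p => f (p + u)) p = funDiff U f (p + u) := by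
  induction U generalizing f with
  | nil => rfl
  | cons w U ih =>
    rw [funDiff_cons, funDiff_cons, ← ih]
    simp only [add_right_comm]

theorem funDiff_sub (U : List E) (f g : E → F) (p : E) :
    funDiff U (fun p => f p - g p) p = funDiff U f p - funDiff U g p := by
  induction U generalizing f g with
  | nil => rfl
  | cons w U ih =>
    rw [funDiff_cons, funDiff_cons, funDiff_cons, ← ih]
    simp only [sub_sub_sub_comm]

/-- Differences commute with translations, so the first increment may be taken last. In this form it
can be estimated by the mean value inequality. -/
theorem funDiff_cons_apply (u : E) (U : List E) (f : E → F) (p : E) :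
    funDiff (u :: U) f p = funDiff U f (p + u) - funDiff U f p := by
  rw [funDiff_cons, funDiff_sub U (fun p => f (p + u)) f, funDiff_comp_add]

/-- The iterated differences of `f` of order at most `n` are bounded by `C` times the product of
the norms of the increments. -/
def DiffBound (n : ℕ) (f : E → F) (C : ℝ) : Prop :=
  ∀ U : List E, U.length ≤ n → ∀ p, ‖funDiff U f p‖ ≤ C * (U.map norm).prod

theorem DiffBound.nonneg {n : ℕ} {f : E → F} {C : ℝ} (h : DiffBound n f C) : 0 ≤ C := by
  have := h [] (Nat.zero_le n) 0
  simp only [List.map_nil, List.prod_nil, mul_one] at this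
  exact (norm_nonneg _).trans this

theorem DiffBound.comp_add {n : ℕ} {f : E → F} {C : ℝ} (h : DiffBound n f C) (u : E) :
    DiffBound n (fun p => f (p + u)) C := fun U hU p => by
  rw [funDiff_comp_add]
  exact h U hU _

theorem DiffBound.diff {n : ℕ} {f : E → F} {C : ℝ} (h : DiffBound (n + 1) f C) (u : E) :
    DiffBound n (fun p => f (p + u) - f p) (C * ‖u‖) := fun U hU p => by
  have := h (u :: U) (by simpa using hU) p
  simpa [funDiff_cons, mul_assoc] using this

theorem DiffBound.of_le {m n : ℕ} {f : E → F} {C : ℝ} (h : DiffBound n f C) (hm : m ≤ n) :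
    DiffBound m f C := fun U hU p => h U (hU.trans hm) p

theorem prod_map_norm_nonneg (U : List E) : 0 ≤ (U.map norm).prod := by
  refine List.prod_nonneg ?_
  simp only [List.mem_map, forall_exists_index, and_imp]
  rintro _ u _ rfl
  exact norm_nonneg u

variable [NormedSpace ℝ E]

theorem funDiff_comp_smul (c : ℝ) (U : List E) (f : E → F) (p : E) :
    funDiff U (fun x => f (c • x)) p = funDiff (U.map (c • ·)) f (c • p) := by
  induction U generalizing f p with
  | nil => rfl
  | cons w U ih => rw [List.map_cons, funDiff_cons_apply, funDiff_cons_apply, ih, ih, smul_add]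

/-- Rescaling multiplies each increment by `c`, so a contraction cannot worsen the bound. The
dilated cutoffs in `mulChain_eq_self` thus share one constant. -/
theorem DiffBound.comp_smul {n : ℕ} {f : E → F} {C : ℝ} (h : DiffBound n f C) {c : ℝ}
    (hc : |c| ≤ 1) : DiffBound n (fun x => f (c • x)) C := fun U hU p => by
  rw [funDiff_comp_smul]
  refine (h _ (by simpa using hU) _).trans (mul_le_mul_of_nonneg_left ?_ h.nonneg)
  clear hU
  induction U with
  | nil => simp
  | cons u U ih =>
    simp only [List.map_cons, List.prod_cons]
    refine mul_le_mul ?_ ih (prod_map_norm_nonneg _) (norm_nonneg u)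
    rw [norm_smul, Real.norm_eq_abs]
    exact mul_le_of_le_one_left (norm_nonneg u) hc

variable [NormedSpace ℝ F]

theorem hasFDerivAt_funDiff (U : List E) {f : E → F} (hf : Differentiable ℝ f) (p : E) :
    HasFDerivAt (funDiff U f) (funDiff U (fderiv ℝ f) p) p := by
  induction U generalizing p with
  | nil => exact (hf p).hasFDerivAt
  | cons u U ih =>
    rw [funDiff_cons_apply]
    have e : funDiff (u :: U) f = fun p => funDiff U f (p + u) - funDiff U f p :=
      funext fun p => funDiff_cons_apply u U f p
    rw [e]
    exact ((hasFDerivAt_comp_add_right u).2 (ih (p + u))).sub (ih p)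

end FunDiff

/-! ### Test functions -/

/-- Smooth functions with compact support. -/
structure IsTest {E F : Type*} [NormedAddCommGroup E] [NormedSpace ℝ E] [NormedAddCommGroup F]
    [NormedSpace ℝ F] (f : E → F) : Prop where
  contDiff : ContDiff ℝ ∞ f
  hasCompactSupport : HasCompactSupport f

theorem IsTest.fderiv {E F : Type*} [NormedAddCommGroup E] [NormedSpace ℝ E]
    [NormedAddCommGroup F] [NormedSpace ℝ F] {f : E → F} (hf : IsTest f) :
    IsTest (fderiv ℝ f) :=
  ⟨hf.contDiff.fderiv_right (m := ∞) (by simp), hf.hasCompactSupport.fderiv ℝ⟩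

theorem IsTest.clm_comp {E F G : Type*} [NormedAddCommGroup E] [NormedSpace ℝ E]
    [NormedAddCommGroup F] [NormedSpace ℝ F] [NormedAddCommGroup G] [NormedSpace ℝ G]
    {f : E → F} (hf : IsTest f) (L : F →L[ℝ] G) : IsTest fun x => L (f x) :=
  ⟨L.contDiff.comp hf.contDiff, hf.hasCompactSupport.comp_left (g := L) (map_zero L)⟩

theorem IsTest.sub {E F : Type*} [NormedAddCommGroup E] [NormedSpace ℝ E]
    [NormedAddCommGroup F] [NormedSpace ℝ F] {f g : E → F} (hf : IsTest f) (hg : IsTest g) :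
    IsTest (f - g) :=
  ⟨hf.contDiff.sub hg.contDiff, hf.hasCompactSupport.sub hg.hasCompactSupport⟩

theorem IsTest.mul_right {E : Type*} [NormedAddCommGroup E] [NormedSpace ℝ E] {f g : E → ℝ}
    (hf : IsTest f) (hg : ContDiff ℝ ∞ g) : IsTest (f * g) :=
  ⟨hf.contDiff.mul hg, hf.hasCompactSupport.mul_right⟩

/-- A cutoff function times a function that is smooth on its support is a test function. -/
theorem IsTest.smul_of_contDiffAt {E F : Type*} [NormedAddCommGroup E] [NormedSpace ℝ E]
    [NormedAddCommGroup F] [NormedSpace ℝ F] {g : E → ℝ} (hg : IsTest g) {f : E → F}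
    (hf : ∀ x ∈ tsupport g, ContDiffAt ℝ ∞ f x) : IsTest fun x => g x • f x :=
  ⟨contDiff_iff_contDiffAt.2 fun x => by
      by_cases hx : x ∈ tsupport g
      · exact hg.contDiff.contDiffAt.smul (hf x hx)
      · refine contDiffAt_const (c := (0 : F)).congr_of_eventuallyEq ?_
        filter_upwards [notMem_tsupport_iff_eventuallyEq.1 hx] with y hy
        rw [hy, Pi.zero_apply, zero_smul],
    hg.hasCompactSupport.smul_right⟩

universe u

/-- Each difference costs one derivative, by the mean value inequality. The induction passes from
`F` to `E →L[ℝ] F`, so `F` is quantified inside and shares the universe of `E`. -/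
theorem IsTest.exists_funDiff_le {E : Type u} [NormedAddCommGroup E] [NormedSpace ℝ E] (n : ℕ) :
    ∀ {F : Type u} [NormedAddCommGroup F] [NormedSpace ℝ F] {f : E → F}, IsTest f →
      ∃ C, ∀ U : List E, U.length = n → ∀ p, ‖funDiff U f p‖ ≤ C * (U.map norm).prod := by
  induction n with
  | zero =>
    intro F _ _ f hf
    obtain ⟨C, hC⟩ := hf.hasCompactSupport.exists_bound_of_continuous hf.contDiff.continuous
    refine ⟨C, fun U hU p => ?_⟩
    rw [List.length_eq_zero_iff.1 hU]
    simpa [funDiff] using hC p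
  | succ n ih =>
    intro F _ _ f hf
    obtain ⟨C, hC⟩ := ih hf.fderiv
    refine ⟨C, fun U hU p => ?_⟩
    obtain ⟨u, U, rfl⟩ := List.exists_of_length_succ U hU
    have h := Convex.norm_image_sub_le_of_norm_hasFDerivWithin_le (𝕜 := ℝ) (s := Set.univ)
      (x := p) (y := p + u)
      (fun x _ => (hasFDerivAt_funDiff U (hf.contDiff.differentiable (by simp)) x).hasFDerivWithinAt)
      (fun x _ => hC U (by simpa using hU) x) convex_univ trivial trivial
    rw [funDiff_cons_apply, List.map_cons, List.prod_cons]
    refine h.trans (le_of_eq ?_)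
    rw [add_sub_cancel_left]
    ring

theorem IsTest.exists_diffBound {E F : Type u} [NormedAddCommGroup E] [NormedSpace ℝ E]
    [NormedAddCommGroup F] [NormedSpace ℝ F] {f : E → F} (hf : IsTest f) (n : ℕ) :
    ∃ C, DiffBound n f C := by
  choose C hC using fun n => hf.exists_funDiff_le n
  obtain ⟨M, hM⟩ := ((Finset.range (n + 1)).image C).bddAbove
  refine ⟨M, fun U hU p => (hC _ U rfl p).trans ?_⟩
  refine mul_le_mul_of_nonneg_right (hM ?_) (prod_map_norm_nonneg U)
  simp only [Finset.coe_image, Finset.coe_range]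
  exact ⟨_, Nat.lt_succ_of_le hU, rfl⟩

/-- A smooth compactly supported cutoff that is `1` near a compact set. -/
theorem exists_isTest_one_nhdsSet {E : Type*} [NormedAddCommGroup E] [NormedSpace ℝ E]
    [FiniteDimensional ℝ E] {K W : Set E} (hK : IsCompact K) (hW : IsOpen W) (hKW : K ⊆ W) :
    ∃ g : E → ℝ, IsTest g ∧ tsupport g ⊆ W ∧ ∀ᶠ x in 𝓝ˢ K, g x = 1 := by
  have : ProperSpace E := FiniteDimensional.proper ℝ E
  obtain ⟨L, hL, hKL, hLW⟩ := exists_compact_between hK hW hKW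
  obtain ⟨g, hg1, hg0, -⟩ := exists_contMDiffMap_one_nhds_of_subset_interior (n := ⊤)
    (modelWithCornersSelf ℝ E) hK.isClosed hKL
  have hs : tsupport g ⊆ L := closure_minimal
    (fun x hx => by_contra fun hn => hx (hg0 x hn)) hL.isClosed
  exact ⟨g, ⟨g.contMDiff.contDiff, hL.of_isClosed_subset (isClosed_tsupport _) hs⟩,
    hs.trans hLW, hg1⟩

/-! ### Multiplication of chains by functions -/

section Mul

variable {E V : Type*} [NormedAddCommGroup E] [NormedAddCommGroup V] [NormedSpace ℝ V]

theorem translate_single (u p : E) (α : V) :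
    translate u (Finsupp.single p α) = Finsupp.single (p + u) α := by
  simp [translate]

/-- Multiplication of a pointed chain by a function, `f · (p; α) = (p; f(p) α)`. -/
def mulPointed (f : E → ℝ) : (E →₀ V) →ₗ[ℝ] (E →₀ V) :=
  Finsupp.lsum ℝ fun p => f p • Finsupp.lsingle p

theorem mulPointed_single (f : E → ℝ) (p : E) (α : V) :
    mulPointed f (Finsupp.single p α) = Finsupp.single p (f p • α) := by
  simp [mulPointed]

theorem mulPointed_apply (f : E → ℝ) (A : E →₀ V) (p : E) : mulPointed f A p = f p • A p := by
  classical
  induction A using Finsupp.induction_linear with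
  | zero => simp
  | add A B hA hB => simp [hA, hB]
  | single q α =>
    rw [mulPointed_single, Finsupp.single_apply, Finsupp.single_apply]
    split_ifs with h
    · rw [h]
    · rw [smul_zero]

theorem support_mulPointed_subset (f : E → ℝ) (A : E →₀ V) :
    ((mulPointed f A).support : Set E) ⊆ Function.support f := by
  intro p hp h0
  rw [Finset.mem_coe, Finsupp.mem_support_iff, mulPointed_apply] at hp
  exact hp (by rw [h0, zero_smul])

theorem mulPointed_sub_left (f g : E → ℝ) (A : E →₀ V) :
    mulPointed (f - g) A = mulPointed f A - mulPointed g A := by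
  ext p
  simp [mulPointed_apply, sub_smul]

theorem mulPointed_eq_zero {f : E → ℝ} {A : E →₀ V}
    (h : ∀ p ∈ A.support, f p = 0) : mulPointed f A = 0 := by
  ext p
  rw [mulPointed_apply, Finsupp.zero_apply]
  by_cases hp : p ∈ A.support
  · rw [h p hp, zero_smul]
  · rw [Finsupp.notMem_support_iff.1 hp, smul_zero]

theorem mulPointed_eq_self {f : E → ℝ} {A : E →₀ V}
    (h : ∀ p ∈ A.support, f p = 1) : mulPointed f A = A := by
  ext p
  rw [mulPointed_apply]
  by_cases hp : p ∈ A.support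
  · rw [h p hp, one_smul]
  · rw [Finsupp.notMem_support_iff.1 hp, smul_zero]

/-- The Leibniz rule for differences. -/
theorem mulPointed_diff (f : E → ℝ) (u : E) (A : E →₀ V) :
    mulPointed f (diff u A) = diff u (mulPointed (fun p => f (p + u)) A) +
      mulPointed (fun p => f (p + u) - f p) A := by
  induction A using Finsupp.induction_linear with
  | zero => simp
  | add A B hA hB => simp only [map_add, hA, hB]; abel
  | single p α =>
    simp only [diff, LinearMap.sub_apply, LinearMap.id_apply, map_sub, translate_single,
      mulPointed_single, sub_smul, Finsupp.single_sub]
    abel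

theorem rNorm_add_le (r : ℕ) (A B : E →₀ V) : rNorm r (A + B) ≤ rNorm r A + rNorm r B :=
  map_add_le_add (rSeminorm E V r) A B

/-- Each use of the Leibniz rule produces two terms, whence the powers of `2`. In one the factor
`‖u‖` comes from the difference of the chain, in the other from the difference of `f`. -/
theorem rNorm_mulPointed_elemChain_le (U : List E) {f : E → ℝ} {C : ℝ}
    (hf : DiffBound U.length f C) (p : E) (α : V) :
    rNorm U.length (mulPointed f (elemChain (U, p, α))) ≤
      2 ^ U.length * C * elemMass (U, p, α) := by
  induction U generalizing f C with
  | nil =>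
    have e : mulPointed f (elemChain (([] : List E), p, α)) =
        elemChain (([] : List E), p, f p • α) := by
      simp [elemChain, iterDiff, mulPointed_single]
    rw [e]
    refine (rNorm_elem_le _ (by simp)).trans ?_
    have := hf [] le_rfl p
    simp only [funDiff, List.map_nil, List.prod_nil, mul_one] at this
    simpa [elemMass, norm_smul] using mul_le_mul_of_nonneg_right this (norm_nonneg α)
  | cons u U ih =>
    rw [elemChain_cons u (U, p, α), elemMass_cons u (U, p, α), mulPointed_diff, List.length_cons]
    have h1 := (rNorm_diff_le (r := U.length) u _).trans
      (mul_le_mul_of_nonneg_left (ih ((hf.of_le (by simp)).comp_add u)) (norm_nonneg u))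
    have h2 := (rNorm_mono (Nat.le_succ U.length) _).trans (ih (DiffBound.diff hf u))
    refine (rNorm_add_le _ _ _).trans ((add_le_add h1 h2).trans (le_of_eq ?_))
    rw [pow_succ]
    ring

theorem norm_mulPointed_le {r : ℕ} {f : E → ℝ} {C : ℝ} (hf : DiffBound r f C) (A : E →₀ V) :
    ‖(ofPointed r ∘ₗ mulPointed f) A‖ ≤ 2 ^ r * C * rNorm r A := by
  refine bound_of_elem _ (mul_nonneg (by positivity) hf.nonneg) (fun t ht => ?_) A
  rw [LinearMap.comp_apply, norm_ofPointed]
  refine (rNorm_mono ht _).trans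
    ((rNorm_mulPointed_elemChain_le t.1 (hf.of_le ht) t.2.1 t.2.2).trans ?_)
  refine mul_le_mul_of_nonneg_right (mul_le_mul_of_nonneg_right ?_ hf.nonneg) (elemMass_nonneg t)
  exact pow_le_pow_right₀ (by norm_num) ht

theorem comap_ofPointed_neBot {r : ℕ} (J : DiffChain E V r) :
    (comap (ofPointed r : (E →₀ V) → DiffChain E V r) (𝓝 J)).NeBot := by
  refine comap_neBot_iff.2 fun t ht => ?_
  obtain ⟨_, hx, A, rfl⟩ := mem_closure_iff_nhds.1 (denseRange_ofPointed J) t ht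
  exact ⟨A, hx⟩

open Classical in
/-- Multiplication of differential chains of order `r` by a function whose differences of order at
most `r` are bounded; zero for other functions. -/
def mulChain (r : ℕ) (f : E → ℝ) : DiffChain E V r →L[ℝ] DiffChain E V r :=
  if h : ∃ C, DiffBound r f C then
    extendBounded (ofPointed r ∘ₗ mulPointed f) _ (norm_mulPointed_le h.choose_spec)
  else 0

theorem mulChain_ofPointed_of_diffBound {r : ℕ} {f : E → ℝ} {C : ℝ} (hf : DiffBound r f C)
    (A : E →₀ V) : mulChain r f (ofPointed r A) = ofPointed r (mulPointed f A) := by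
  rw [mulChain, dif_pos ⟨C, hf⟩, extendBounded_ofPointed, LinearMap.comp_apply]

/-- Any admissible `C` works, not only the one chosen inside `mulChain`, since the estimate is
checked on the dense pointed chains. A family of functions with a common `C` is therefore uniformly
bounded as operators. -/
theorem norm_mulChain_le {r : ℕ} {f : E → ℝ} {C : ℝ} (hf : DiffBound r f C)
    (J : DiffChain E V r) : ‖mulChain r f J‖ ≤ 2 ^ r * C * ‖J‖ := by
  refine denseRange_ofPointed.induction_on J ?_ fun A => ?_
  · exact isClosed_le (by fun_prop) (by fun_prop)
  · rw [mulChain_ofPointed_of_diffBound hf, norm_ofPointed A]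
    exact norm_mulPointed_le hf A

end Mul

/-! ### Localization of chains near their support -/

section MulTest

variable {E V : Type} [NormedAddCommGroup E] [NormedSpace ℝ E] [NormedAddCommGroup V]
  [NormedSpace ℝ V] {r : ℕ}

theorem mulChain_ofPointed {f : E → ℝ} (hf : IsTest f) (A : E →₀ V) :
    mulChain r f (ofPointed r A) = ofPointed r (mulPointed f A) :=
  (hf.exists_diffBound r).elim fun _ h => mulChain_ofPointed_of_diffBound h A

theorem mulChain_sub {f g : E → ℝ} (hf : IsTest f) (hg : IsTest g) (J : DiffChain E V r) :
    mulChain r (f - g) J = mulChain r f J - mulChain r g J := by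
  refine denseRange_ofPointed.induction_on J ?_ fun A => ?_
  · exact isClosed_eq (by fun_prop) (by fun_prop)
  · rw [mulChain_ofPointed hf, mulChain_ofPointed hg, mulChain_ofPointed (hf.sub hg),
      mulPointed_sub_left, map_sub]

theorem mulChain_zero (J : DiffChain E V r) : mulChain r (0 : E → ℝ) J = 0 := by
  have h0 : IsTest (0 : E → ℝ) := ⟨contDiff_const, HasCompactSupport.zero⟩
  simpa using mulChain_sub h0 h0 J

/-- Multiplication by a test function whose support misses a supporting set annihilates `J`. -/
theorem Supports.mulChain_eq_zero [Nontrivial E] {X : Set E} {J : DiffChain E V r}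
    (hJ : Supports X J) {f : E → ℝ} (hf : IsTest f) (hX : Disjoint X (tsupport f)) :
    mulChain r f J = 0 := by
  have : NoncompactSpace E := NormedSpace.noncompactSpace ℝ E
  -- `Supports` only speaks of non-empty open sets; the complement of a compact support is non-empty
  -- because `E` is not compact.
  obtain ⟨A, hA, hlim⟩ := hJ (tsupport f)ᶜ
    (Set.nonempty_compl.2 fun h => noncompact_univ E (h ▸ hf.hasCompactSupport))
    (isClosed_tsupport f).isOpen_compl hX.subset_compl_right
  refine tendsto_nhds_unique (((mulChain r f).continuous.tendsto J).comp hlim) ?_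
  refine tendsto_const_nhds.congr fun i => ?_
  rw [Function.comp_apply, mulChain_ofPointed hf, mulPointed_eq_zero, map_zero]
  exact fun p hp => image_eq_zero_of_notMem_tsupport (hA i hp)

variable [FiniteDimensional ℝ E] [Nontrivial E]

/-- Multiplication by a test function whose support misses the support of `J` annihilates `J`. -/
theorem mulChain_eq_zero_of_disjoint_supp {J : DiffChain E V r} {f : E → ℝ} (hf : IsTest f)
    (hJ : Disjoint (supp J) (tsupport f)) : mulChain r f J = 0 := by
  -- Compactness induction on subsets of `tsupport f`: finitely many local factors `1 - g` multiply
  -- to a smooth `ψ` that vanishes on `tsupport f` and does not affect products with `J`. Then `f *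
  -- ψ = 0` gives the claim.
  have key : ∃ ψ : E → ℝ, ContDiff ℝ ∞ ψ ∧ (∀ x ∈ tsupport f, ψ x = 0) ∧
      ∀ g : E → ℝ, IsTest g → mulChain r g J = mulChain r (g * ψ) J := by
    refine hf.hasCompactSupport.isCompact.induction_on
      (p := fun s => ∃ ψ : E → ℝ, ContDiff ℝ ∞ ψ ∧ (∀ x ∈ s, ψ x = 0) ∧
        ∀ g : E → ℝ, IsTest g → mulChain r g J = mulChain r (g * ψ) J) ?_ ?_ ?_ ?_
    · exact ⟨1, contDiff_const, by simp, fun g _ => by rw [mul_one]⟩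
    · rintro s t hst ⟨ψ, h1, h2, h3⟩
      exact ⟨ψ, h1, fun x hx => h2 x (hst hx), h3⟩
    · rintro s t ⟨ψ, h1, h2, h3⟩ ⟨φ, k1, k2, k3⟩
      refine ⟨ψ * φ, h1.mul k1, ?_, fun g hg => ?_⟩
      · rintro x (hx | hx)
        · simp [h2 x hx]
        · simp [k2 x hx]
      · rw [h3 g hg, k3 _ (hg.mul_right h1), mul_assoc]
    · intro x hx
      have hx' : x ∉ supp J := fun h => Set.disjoint_left.1 hJ h hx
      simp only [supp, Set.mem_sInter, not_forall] at hx'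
      obtain ⟨X, ⟨hXc, hX⟩, hxX⟩ := hx'
      obtain ⟨g, hg, hgX, hg1⟩ := exists_isTest_one_nhdsSet (isCompact_singleton (x := x))
        hXc.isOpen_compl (by simpa using hxX)
      rw [nhdsSet_singleton] at hg1
      refine ⟨_, mem_nhdsWithin_of_mem_nhds hg1, 1 - g, contDiff_const.sub hg.contDiff, ?_, ?_⟩
      · intro y hy
        simp [show g y = 1 from hy]
      · intro f hf
        -- The support of `g` misses the single supporting set `X`, so the part of `f` cut out by
        -- `g` does not see `J`.
        have h0 : mulChain r (f * g) J = 0 := hX.mulChain_eq_zero (hf.mul_right hg.contDiff)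
          (Set.disjoint_left.2 fun y hy hy' => hgX (tsupport_mul_subset_right hy') hy)
        rw [mul_sub, mul_one, mulChain_sub hf (hf.mul_right hg.contDiff), h0, sub_zero]
  obtain ⟨ψ, -, h2, h3⟩ := key
  have e : f * ψ = 0 := by
    funext x
    by_cases hx : x ∈ tsupport f
    · simp [h2 x hx]
    · simp [image_eq_zero_of_notMem_tsupport hx]
  rw [h3 f hf, e, mulChain_zero]

/-- A cutoff that is `1` near the compact support of `J` does not change `J`. -/
theorem mulChain_eq_self {J : DiffChain E V r} (hJ : IsCompact (supp J)) {g : E → ℝ}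
    (hg : IsTest g) (hg1 : ∀ᶠ x in 𝓝ˢ (supp J), g x = 1) : mulChain r g J = J := by
  have : ProperSpace E := FiniteDimensional.proper ℝ E
  obtain ⟨φ, hφ, -, hφ1⟩ := exists_isTest_one_nhdsSet (isCompact_closedBall (0 : E) 1)
    isOpen_univ (Set.subset_univ _)
  have hφ1 : ∀ x, ‖x‖ ≤ 1 → φ x = 1 := fun x hx =>
    hφ1.self_of_nhdsSet x (mem_closedBall_zero_iff.2 hx)
  -- Dilated cutoffs, equal to `1` on balls exhausting `E`, with difference bounds independent of
  -- `n`.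
  let Φ : ℕ → E → ℝ := fun n x => φ (((n : ℝ) + 1)⁻¹ • x)
  have hΦ : ∀ n, IsTest (Φ n) := fun n =>
    ⟨hφ.contDiff.comp (contDiff_const_smul _),
      hφ.hasCompactSupport.comp_smul (inv_ne_zero (by positivity))⟩
  have hΦ1 : ∀ (n : ℕ) (x : E), ‖x‖ ≤ (n : ℝ) + 1 → Φ n x = 1 := fun n x hx => by
    refine hφ1 _ ?_
    rw [norm_smul, norm_inv, Real.norm_of_nonneg (by positivity), inv_mul_le_iff₀ (by positivity),
      mul_one]
    exact hx
  obtain ⟨C, hC⟩ := hφ.exists_diffBound r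
  have hΦC : ∀ n, DiffBound r (Φ n) C := fun n => hC.comp_smul (by
    rw [abs_inv, abs_of_nonneg (by positivity)]
    exact inv_le_one_of_one_le₀ (by linarith [n.cast_nonneg (α := ℝ)]))
  obtain ⟨R, hR⟩ := hJ.isBounded.exists_norm_le
  -- Once the ball of radius `n + 1` contains `supp J`, both `Φ n` and `g` equal `1` near it, so
  -- their difference annihilates `J`.
  have hev : ∀ᶠ n : ℕ in atTop, mulChain r (Φ n) J = mulChain r g J := by
    filter_upwards [eventually_ge_atTop ⌈R⌉₊] with n hn
    rw [← sub_eq_zero, ← mulChain_sub (hΦ n) hg]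
    refine mulChain_eq_zero_of_disjoint_supp ((hΦ n).sub hg) (Set.disjoint_left.2 fun x hx => ?_)
    rw [notMem_tsupport_iff_eventuallyEq]
    have hxn : ‖x‖ < (n : ℝ) + 1 := by
      have := hR x hx
      have := Nat.ceil_le.1 hn
      linarith
    filter_upwards [eventually_nhdsSet_iff_forall.1 hg1 x hx,
      continuous_norm.continuousAt.eventually_lt continuousAt_const hxn] with y hy hyn
    rw [Pi.sub_apply, hy, hΦ1 n y hyn.le, sub_self, Pi.zero_apply]
  -- For `n` large depending on `A`, `Φ n` fixes `A` and may replace `g` on `J`. The constant does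
  -- not depend on `n`, so letting `A → J` gives `g · J = J`.
  have hdist : ∀ A : E →₀ V, ‖mulChain r g J - J‖ ≤ (2 ^ r * C + 1) * ‖J - ofPointed r A‖ := by
    intro A
    obtain ⟨S, hS⟩ := A.support.finite_toSet.isBounded.exists_norm_le
    obtain ⟨n, hn, hnS⟩ := (hev.and (eventually_ge_atTop ⌈S⌉₊)).exists
    have hA : mulChain r (Φ n) (ofPointed r A) = ofPointed r A := by
      rw [mulChain_ofPointed (hΦ n), mulPointed_eq_self]
      intro p hp
      refine hΦ1 n p ?_
      have := hS p hp
      have := Nat.ceil_le.1 hnS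
      linarith
    have e : mulChain r g J - J =
        mulChain r (Φ n) (J - ofPointed r A) - (J - ofPointed r A) := by
      rw [map_sub, hA, hn]
      abel
    rw [e]
    refine (norm_sub_le _ _).trans ?_
    rw [add_mul, one_mul]
    gcongr
    exact norm_mulChain_le (hΦC n) _
  have hlim : Tendsto (fun A : E →₀ V => (2 ^ r * C + 1) * ‖J - ofPointed r A‖)
      (comap (ofPointed r) (𝓝 J)) (𝓝 0) := by
    have h : Tendsto (fun I : DiffChain E V r => (2 ^ r * C + 1) * ‖J - I‖) (𝓝 J)
        (𝓝 ((2 ^ r * C + 1) * ‖J - J‖)) := Continuous.tendsto (by fun_prop) J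
    rw [sub_self, norm_zero, mul_zero] at h
    exact h.comp tendsto_comap
  have := comap_ofPointed_neBot J
  exact sub_eq_zero.1 (norm_le_zero_iff.1 (ge_of_tendsto hlim (Eventually.of_forall hdist)))

/-- A chain with compact support is a limit of pointed chains supported in any given
neighbourhood of its support. -/
theorem exists_tendsto_ofPointed {J : DiffChain E V r} (hJ : IsCompact (supp J)) {W : Set E}
    (hW : W ∈ 𝓝ˢ (supp J)) : ∃ᶠ A in comap (ofPointed r : (E →₀ V) → DiffChain E V r) (𝓝 J),
      (A.support : Set E) ⊆ W := by
  obtain ⟨g, hg, hgW, hg1⟩ := exists_isTest_one_nhdsSet hJ isOpen_interior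
    (subset_interior_iff_mem_nhdsSet.2 hW)
  have := comap_ofPointed_neBot J
  -- Multiplication by `g` preserves convergence to `J`, because `g · J = J`, and forces the
  -- supports into `W`.
  have hlim : Tendsto (fun A : E →₀ V => mulPointed g A) (comap (ofPointed r) (𝓝 J))
      (comap (ofPointed r) (𝓝 J)) := by
    rw [tendsto_comap_iff]
    have h := ((mulChain r g).continuous.tendsto J).comp
      (tendsto_comap (f := (ofPointed r : (E →₀ V) → DiffChain E V r)))
    rw [mulChain_eq_self hJ hg hg1] at h
    exact h.congr fun A => mulChain_ofPointed hg A
  refine hlim.frequently (Eventually.frequently (Eventually.of_forall fun A => ?_))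
  exact (support_mulPointed_subset g A).trans
    ((subset_tsupport g).trans (hgW.trans interior_subset))

end MulTest

/-! ### Pairing of chains with test forms -/

section Pairing

variable {E V W : Type*} [NormedAddCommGroup E] [NormedAddCommGroup V] [NormedSpace ℝ V]
  [NormedAddCommGroup W] [NormedSpace ℝ W]

/-- The value `∑ f_{p_i}(α_i)` of a covector field on a pointed chain. -/
def evalPointed (f : E → V →L[ℝ] W) : (E →₀ V) →ₗ[ℝ] W :=
  Finsupp.lsum ℝ fun p => (f p).toLinearMap

theorem evalPointed_single (f : E → V →L[ℝ] W) (p : E) (α : V) :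
    evalPointed f (Finsupp.single p α) = f p α := by
  simp [evalPointed]

theorem evalPointed_diff (f : E → V →L[ℝ] W) (u : E) (A : E →₀ V) :
    evalPointed f (diff u A) = evalPointed (fun p => f (p + u) - f p) A := by
  induction A using Finsupp.induction_linear with
  | zero => simp
  | add A B hA hB => simp only [map_add, hA, hB]
  | single p α =>
    simp only [diff, LinearMap.sub_apply, LinearMap.id_apply, map_sub, translate_single,
      evalPointed_single, sub_apply]

/-- Summation by parts: differences of the chain move onto the form. This turns `DiffBound` into a
bound in the `r`-norm. -/
theorem evalPointed_elemChain (f : E → V →L[ℝ] W) (U : List E) (p : E) (α : V) :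
    evalPointed f (elemChain (U, p, α)) = funDiff U f p α := by
  induction U generalizing f with
  | nil => simp [elemChain, iterDiff, evalPointed_single, funDiff]
  | cons u U ih => rw [elemChain_cons u (U, p, α), evalPointed_diff, ih, funDiff_cons]

theorem norm_evalPointed_le {r : ℕ} {f : E → V →L[ℝ] W} {C : ℝ} (hf : DiffBound r f C)
    (A : E →₀ V) : ‖evalPointed f A‖ ≤ C * rNorm r A := by
  refine bound_of_elem _ hf.nonneg (fun ⟨U, p, α⟩ ht => ?_) A
  rw [evalPointed_elemChain, elemMass, ← mul_assoc]
  exact (ContinuousLinearMap.le_opNorm _ _).trans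
    (mul_le_mul_of_nonneg_right (hf U ht p) (norm_nonneg α))

end Pairing

/-! ### Pairing with test forms, and the dual of the prederivative -/

section PairingTest

variable {E V W : Type} [NormedAddCommGroup E] [NormedSpace ℝ E] [NormedAddCommGroup V]
  [NormedSpace ℝ V] [NormedAddCommGroup W] [NormedSpace ℝ W]

/-- Pairing with a test form extends to differential chains of any order. -/
theorem IsTest.exists_pairing [CompleteSpace W] {f : E → V →L[ℝ] W} (hf : IsTest f) (r : ℕ) :
    ∃ Φ : DiffChain E V r →L[ℝ] W, ∀ A, Φ (ofPointed r A) = evalPointed f A := by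
  obtain ⟨C, hC⟩ := hf.exists_diffBound r
  exact ⟨extendBounded (evalPointed f) C (norm_evalPointed_le hC), extendBounded_ofPointed _ _ _⟩

/-- Pairing the prederivative `P_v A` with a `0`-form is pairing `A` with its derivative in the
direction `v`. -/
theorem pairing_prederivPointed {r : ℕ} (hr : 1 ≤ r) {G : E → W} (hG : Differentiable ℝ G)
    {Φ : DiffChain E ℝ (r + 1) →L[ℝ] W}
    (hΦ : ∀ A, Φ (ofPointed (r + 1) A) =
      evalPointed (fun p => ContinuousLinearMap.toSpanSingleton ℝ (G p)) A) (v : E)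
    (p : E) (a : ℝ) :
    Φ (prederivPointed hr v (Finsupp.single p a)) = a • fderiv ℝ G p v := by
  have h1 := (Φ.continuous.tendsto _).comp (tendsto_prederivPointed hr v (Finsupp.single p a))
  refine tendsto_nhds_unique h1 ?_
  -- After moving the difference onto `G`, the quotients defining `P_v` become the slopes of `G` in
  -- direction `v`.
  have h2 := ((hG p).hasFDerivAt.hasLineDerivAt v).tendsto_slope_zero.const_smul a
  refine h2.congr fun t => ?_
  have e : diffQuot (r + 1) v t (Finsupp.single p a) =
      t⁻¹ • ofPointed (r + 1) (diff (t • v) (Finsupp.single p a)) := by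
    simp [diffQuot]
  rw [Function.comp_apply, e, map_smul, hΦ, evalPointed_diff, evalPointed_single]
  simp only [sub_apply, ContinuousLinearMap.toSpanSingleton_apply]
  rw [smul_comm, smul_sub]

end PairingTest

/-! ### Integrals over plane chains -/

section Plane

variable {r : ℕ}

/-- Stokes' theorem for test functions: pairing `∂A` with `G` is pairing `A` with `dG`. -/
theorem pairing_boundary (hr : 1 ≤ r) {G : ℂ → ℂ} (hG : Differentiable ℝ G)
    {Φ : DiffChain ℂ ℝ (r + 1) →L[ℝ] ℂ}
    (hΦ : ∀ A, Φ (ofPointed (r + 1) A) =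
      evalPointed (fun p => ContinuousLinearMap.toSpanSingleton ℝ (G p)) A) (A : ℂ →₀ ℂ) :
    Φ (boundary hr (ofPointed r A)) = evalPointed (fderiv ℝ G) A := by
  induction A using Finsupp.induction_linear with
  | zero => simp
  | add A B hA hB => rw [map_add, map_add, map_add, map_add, hA, hB]
  | single p α =>
    have h : ∀ v : ℂ, Φ (prederiv hr v (retract v (ofPointed r (Finsupp.single p α)))) =
        (inner ℝ v α : ℝ) • fderiv ℝ G p v := fun v => by
      rw [retract, extendBounded_ofPointed, LinearMap.comp_apply, prederiv,
        extendBounded_ofPointed, retractPointed, Finsupp.mapRange.linearMap_apply,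
        Finsupp.mapRange_single]
      exact pairing_prederivPointed hr hG hΦ v p _
    simp only [boundary, sum_apply, ContinuousLinearMap.comp_apply, map_sum, h]
    rw [evalPointed_single]
    -- Expanding `α` in the orthonormal basis gives `dG(α) = ∑ ⟪v_i, α⟫ dG(v_i)`.
    conv_rhs => rw [← Complex.orthonormalBasisOneI.sum_repr' α, map_sum]
    simp only [map_smul]

theorem eventually_approx_support {J : PlaneChain r} {p : ℂ → Prop}
    (hp : ∀ᶠ w in 𝓝ˢ (supp J), p w) : ∀ᶠ A in approx J, ∀ w ∈ A.support, p w := by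
  have h : ∀ᶠ s in (𝓝ˢ (supp J)).smallSets, ∀ w ∈ s, p w := hp.smallSets
  exact (tendsto_comap.eventually h).filter_mono inf_le_right

theorem approx_neBot {J : PlaneChain r} (hJ : IsCompact (supp J)) : (approx J).NeBot := by
  refine inf_neBot_iff.2 fun {s} hs {t} ht => ?_
  obtain ⟨S, hS, hSt⟩ := mem_comap.1 ht
  obtain ⟨W, hW, hWS⟩ := eventually_smallSets.1 hS
  obtain ⟨A, hA, hAs⟩ := ((exists_tendsto_ofPointed hJ hW).and_eventually hs).exists
  exact ⟨A, hAs, hSt (hWS _ hA)⟩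

theorem evalForm_eq_evalPointed {η : ℂ → ℂ →ₗ[ℝ] ℂ} {f : ℂ → ℂ →L[ℝ] ℂ} {A : ℂ →₀ ℂ}
    (h : ∀ w ∈ A.support, η w = (f w).toLinearMap) : evalForm η A = evalPointed f A := by
  rw [evalForm, evalPointed, Finsupp.lsum_apply]
  exact Finsupp.sum_congr fun w hw => by rw [h w hw]

theorem tendsto_pairing_approx {J : PlaneChain r} (Φ : PlaneChain r →L[ℝ] ℂ) :
    Tendsto (fun A => Φ (ofPointed r A)) (approx J) (𝓝 (Φ J)) :=
  ((Φ.continuous.tendsto J).comp tendsto_comap).mono_left inf_le_left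

/-- A form that is smooth near the compact support of `J` has an integral over `J`. -/
theorem exists_hasIntegral {J : PlaneChain r} (hJ : IsCompact (supp J)) {f : ℂ → ℂ}
    {W : Set ℂ} (hW : IsOpen W) (hJW : supp J ⊆ W) (hf : ∀ w ∈ W, ContDiffAt ℝ ∞ f w) :
    ∃ c, HasIntegral J (formDw f) c := by
  obtain ⟨g, hg, hgW, hg1⟩ := exists_isTest_one_nhdsSet hJ hW hJW
  have ht := (hg.smul_of_contDiffAt fun w hw => hf w (hgW hw)).clm_comp
    (ContinuousLinearMap.mul ℝ ℂ)
  obtain ⟨Φ, hΦ⟩ := ht.exists_pairing r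
  -- The cutoff form has integral `Φ J`; it agrees with `f dw` on chains supported where `g = 1`,
  -- which holds eventually along `approx J`.
  refine ⟨Φ J, approx_neBot hJ, (tendsto_pairing_approx Φ).congr' ?_⟩
  filter_upwards [eventually_approx_support hg1] with A hA
  rw [hΦ, eq_comm]
  refine evalForm_eq_evalPointed fun w hw => LinearMap.ext fun α => ?_
  simp [formDw, hA w hw]

/-- The integral over a closed chain of a form that is exact near the support vanishes. -/
theorem tendsto_evalForm_of_exact (hr : 1 ≤ r) {J : PlaneChain r} (hJ : IsCompact (supp J))
    (hclosed : boundary hr J = 0) {F f : ℂ → ℂ} {W : Set ℂ} (hW : IsOpen W) (hJW : supp J ⊆ W)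
    (hFs : ∀ w ∈ W, ContDiffAt ℝ ∞ F w) (hF : ∀ w ∈ W, HasDerivAt F (f w) w) :
    Tendsto (evalForm (formDw f)) (approx J) (𝓝 0) := by
  obtain ⟨g, hg, hgW, hg1⟩ := exists_isTest_one_nhdsSet hJ hW hJW
  have ht := hg.smul_of_contDiffAt fun w hw => hFs w (hgW hw)
  have ht' : IsTest fun p => ContinuousLinearMap.toSpanSingleton ℝ (g p • F p) :=
    ht.clm_comp (ContinuousLinearMap.toSpanSingletonCLE (𝕜 := ℝ) (E := ℂ)).toContinuousLinearMap
  obtain ⟨Φ, hΦ⟩ := ht'.exists_pairing (r + 1)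
  have h := tendsto_pairing_approx (J := J) (Φ.comp (boundary hr))
  rw [ContinuousLinearMap.comp_apply, hclosed, map_zero] at h
  refine h.congr' ?_
  -- Equality on a neighbourhood of each point `w` is needed, not only at `w`, since the derivatives
  -- of `g • F` and `F` are compared.
  have hev : ∀ᶠ w in 𝓝ˢ (supp J), (fun w => g w • F w) =ᶠ[𝓝 w] F ∧ w ∈ W := by
    filter_upwards [hg1.eventually_nhdsSet, hW.mem_nhdsSet.2 hJW] with w hw hwW
    refine ⟨?_, hwW⟩
    filter_upwards [hw] with y hy
    rw [hy, one_smul]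
  filter_upwards [eventually_approx_support hev] with A hA
  rw [ContinuousLinearMap.comp_apply,
    pairing_boundary hr (ht.contDiff.differentiable (by simp)) hΦ, eq_comm]
  refine evalForm_eq_evalPointed fun w hw => LinearMap.ext fun α => ?_
  have hd := (hF w (hA w hw).2).complexToReal_fderiv.congr_of_eventuallyEq (hA w hw).1
  rw [hd.fderiv]
  simp [formDw]

/-- The winding number does not change when the point moves inside a disk off the support. -/
theorem windingNumber_eq_of_mem_ball (hr : 1 ≤ r) {J : PlaneChain r} (hJ : IsCompact (supp J))
    (hclosed : boundary hr J = 0) {z z' : ℂ} {ρ : ℝ}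
    (hρ : Metric.closedBall z ρ ⊆ (supp J)ᶜ) (hz' : z' ∈ Metric.ball z ρ)
    (hex : ∀ z ∈ (supp J)ᶜ, ∃ c, HasIntegral J (formDw fun w => 1 / (w - z)) c) :
    windingNumber J z' = windingNumber J z := by
  have hneBot := approx_neBot hJ
  obtain ⟨c, hc⟩ := hex z (hρ (Metric.mem_closedBall_self (Metric.pos_of_mem_ball hz').le))
  obtain ⟨c', hc'⟩ := hex z' (hρ (Metric.ball_subset_closedBall hz'))
  -- Off the closed disk `‖z - z'‖ < ρ < ‖w - z‖`, so the argument of the logarithm stays within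
  -- distance `1` of `1`, away from the branch cut.
  have hslit : ∀ w ∈ (Metric.closedBall z ρ)ᶜ, w ≠ z ∧ w ≠ z' ∧
      1 + (z - z') / (w - z) ∈ Complex.slitPlane := by
    intro w hw
    rw [Set.mem_compl_iff, Metric.mem_closedBall, not_le, dist_eq_norm] at hw
    rw [Metric.mem_ball, dist_comm, dist_eq_norm] at hz'
    have hwz : w ≠ z := by
      rintro rfl
      rw [sub_self, norm_zero] at hw
      linarith [norm_nonneg (w - z')]
    refine ⟨hwz, ?_, ?_⟩
    · rintro rfl
      rw [norm_sub_rev] at hw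
      linarith
    · refine Complex.mem_slitPlane_of_norm_lt_one ?_
      rw [norm_div, div_lt_one (norm_pos_iff.2 (sub_ne_zero.2 hwz))]
      linarith
  have hlim := tendsto_evalForm_of_exact hr hJ hclosed
    (F := fun w => Complex.log (1 + (z - z') / (w - z)))
    (f := fun w => 1 / (w - z') - 1 / (w - z)) Metric.isClosed_closedBall.isOpen_compl
    (Set.subset_compl_comm.1 hρ) ?_ ?_
  · have e : evalForm (formDw fun w => 1 / (w - z') - 1 / (w - z)) = fun A =>
        evalForm (formDw fun w => 1 / (w - z')) A - evalForm (formDw fun w => 1 / (w - z)) A := by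
      funext A
      simp only [evalForm, formDw, ← Finsupp.sum_sub, LinearMap.mulLeft_apply, sub_mul]
    rw [e] at hlim
    have := tendsto_nhds_unique (hc'.2.sub hc.2) hlim
    rw [windingNumber, windingNumber, harrisonIntegral, harrisonIntegral, hc.2.limUnder_eq,
      hc'.2.limUnder_eq, sub_eq_zero.1 this]
  · intro w hw
    obtain ⟨h1, -, h3⟩ := hslit w hw
    have h4 : ContDiffAt ℂ ∞ (fun w => 1 + (z - z') / (w - z)) w := contDiffAt_const.add
      (contDiffAt_const.div (contDiffAt_id.sub contDiffAt_const) (sub_ne_zero.2 h1))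
    have h : ContDiffAt ℂ ∞ (fun w => Complex.log (1 + (z - z') / (w - z))) w :=
      ContDiffAt.comp (g := Complex.log) w (Complex.contDiffAt_log h3) h4
    exact h.restrict_scalars ℝ
  · intro w hw
    obtain ⟨h1, h2, h3⟩ := hslit w hw
    have h1 := sub_ne_zero.2 h1
    have h2 := sub_ne_zero.2 h2
    have h := (((hasDerivAt_const w (z - z')).div ((hasDerivAt_id w).sub_const z)
      h1).const_add 1).clog h3
    refine h.congr_deriv ?_
    -- The primitive is thus a branch of `log ((w - z') / (w - z))`, whose derivative is the
    -- difference of the two kernels.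
    have e : 1 + (z - z') / (w - z) = (w - z') / (w - z) := by
      field_simp
      ring
    simp only [id, Pi.div_apply, e]
    field_simp
    ring

end Plane

end HarrisonChain

end

/-! ### Existence of the integral and constancy on components -/

theorem mainTheorem4 (r : ℕ) (hr : 1 ≤ r) (J : HarrisonChain.PlaneChain r)
    (hclosed : HarrisonChain.boundary hr J = 0)
    (hcompact : IsCompact (HarrisonChain.supp J)) :
    (∀ z ∈ (HarrisonChain.supp J)ᶜ, ∃ c : ℂ,
      HarrisonChain.HasIntegral J (HarrisonChain.formDw fun w => 1 / (w - z)) c) ∧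
    ∀ z ∈ (HarrisonChain.supp J)ᶜ, ∀ z' ∈ connectedComponentIn (HarrisonChain.supp J)ᶜ z,
      HarrisonChain.windingNumber J z' = HarrisonChain.windingNumber J z := by
  have hex : ∀ z ∈ (HarrisonChain.supp J)ᶜ, ∃ c : ℂ,
      HarrisonChain.HasIntegral J (HarrisonChain.formDw fun w => 1 / (w - z)) c := by
    intro z hz
    refine HarrisonChain.exists_hasIntegral hcompact (W := {z}ᶜ) isOpen_compl_singleton
      (Set.subset_compl_singleton_iff.2 hz) fun w hw => ?_
    have h : ContDiffAt ℂ (↑(⊤ : ℕ∞)) (fun w => 1 / (w - z)) w :=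
      contDiffAt_const.div (contDiffAt_id.sub contDiffAt_const) (sub_ne_zero.2 hw)
    exact h.restrict_scalars ℝ
  refine ⟨hex, fun z hz z' hz' => ?_⟩
  -- A symmetric, transitive relation that holds locally holds throughout a preconnected set; the
  -- local case is a disk off the closed set `supp J`.
  refine isPreconnected_connectedComponentIn.induction₂
    (fun x y => HarrisonChain.windingNumber J y = HarrisonChain.windingNumber J x)
    (fun x hx => ?_) (fun x y w _ _ _ h1 h2 => h2.trans h1) (fun x y _ _ h => h.symm)
    (mem_connectedComponentIn hz) hz'
  obtain ⟨ρ, hρ0, hρ⟩ := Metric.nhds_basis_closedBall.mem_iff.1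
    (hcompact.isClosed.isOpen_compl.mem_nhds (connectedComponentIn_subset _ _ hx))
  filter_upwards [mem_nhdsWithin_of_mem_nhds (Metric.ball_mem_nhds x hρ0)] with y hy
  exact HarrisonChain.windingNumber_eq_of_mem_ball hr hcompact hclosed hρ hy hex
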